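/- Let $d\ge 0$ and $n\ge 1$ be integers, and let $\boldsymbol A=(A_1,\dots,A_d)$ be a doubly commuting tuple of complex $n\times n$ matrices, that is, $A_iA_j=A_jA_i$ and $A_i^*A_j=A_jA_i^*$ for all $i\neq j$. Regard $\boldsymbol A$ as the operator $\mathbb C^n\to(\mathbb C^n)^d$, $\boldsymbol A x=(A_1x,\dots,A_dx)$, where $(\mathbb C^n)^d$ is the Hilbert space direct sum, and let $\|\boldsymbol A\|=\big\|\sum_{j=1}^d A_j^*A_j\big\|^{1/2}$ be its operator norm. For $\boldsymbol z=(z_1,\dots,z_d)\in\mathbb C^d$ let $\boldsymbol z\boldsymbol I=(z_1I,\dots,z_dI)$, and put $\operatorname{dist}(\boldsymbol A,\mathbb C^d\boldsymbol I)=\inf_{\boldsymbol z\in\mathbb C^d}\|\boldsymbol A-\boldsymbol z\boldsymbol I\|$. For $x\in\mathbb C^n$ let $\operatorname{var}_x(\boldsymbol A)=\|\boldsymbol Ax\|^2-\sum_{j=1}^d|\langle x|A_jx\rangle|^2$. Then the infimum defining $\operatorname{dist}(\boldsymbol A,\mathbb C^d\boldsymbol I)$ is a minimum, the maximum of $\operatorname{var}_x(\boldsymbol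 A)$ over unit vectors $x\in\mathbb C^n$ is attained, and $$\operatorname{dist}(\boldsymbol A,\mathbb C^d\boldsymbol I)^2=\max_{\|x\|=1}\operatorname{var}_x(\boldsymbol A).$$ -/

import Mathlib

open scoped Matrix

/-- A tuple of matrices is doubly commuting if `A i` commutes with `A j` and its conjugate
transpose commutes with `A j` whenever `i ≠ j` (nothing is required for `i = j`). -/
def DoublyCommuting {d n : ℕ} (A : Fin d → Matrix (Fin n) (Fin n) ℂ) : Prop :=
  ∀ i j, i ≠ j → A i * A j = A j * A i ∧ (A i)ᴴ * A j = A j * (A i)ᴴ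

noncomputable section

/-- The tuple as the operator `x ↦ (A₁ x, …, A_d x)` from `ℂⁿ` to the Hilbert direct sum of `d`
copies of `ℂⁿ`. Its norm is the operator norm. -/
def tupleOp {d n : ℕ} (A : Fin d → Matrix (Fin n) (Fin n) ℂ) :
    EuclideanSpace ℂ (Fin n) →L[ℂ] PiLp 2 (fun _ : Fin d => EuclideanSpace ℂ (Fin n)) :=
  ((PiLp.continuousLinearEquiv 2 ℂ
      (fun _ : Fin d => EuclideanSpace ℂ (Fin n))).symm.toContinuousLinearMap).comp
    (ContinuousLinearMap.pi fun j => Matrix.toEuclideanCLM (n := Fin n) (𝕜 := ℂ) (A j))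

/-- The tuple `zI = (z₁ I, …, z_d I)`. -/
def scalarTuple {d : ℕ} (n : ℕ) (z : Fin d → ℂ) : Fin d → Matrix (Fin n) (Fin n) ℂ :=
  fun j => z j • (1 : Matrix (Fin n) (Fin n) ℂ)

/-- The distance of a tuple from the scalar tuples: the infimum of `‖A - zI‖` over `z ∈ ℂᵈ`. -/
def distToScalars {d n : ℕ} (A : Fin d → Matrix (Fin n) (Fin n) ℂ) : ℝ :=
  ⨅ z : Fin d → ℂ, ‖tupleOp (A - scalarTuple n z)‖

/-- The variance `‖A x‖² - ∑ⱼ |⟨x, Aⱼ x⟩|²` of a tuple with respect to `x`. -/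
def tupleVar {d n : ℕ} (A : Fin d → Matrix (Fin n) (Fin n) ℂ) (x : EuclideanSpace ℂ (Fin n)) : ℝ :=
  ‖tupleOp A x‖ ^ 2
    - ∑ j, ‖inner ℂ x (Matrix.toEuclideanCLM (n := Fin n) (𝕜 := ℂ) (A j) x)‖ ^ 2

end

/-! On unit vectors the variance does not change when scalars are subtracted from the tuple, so it
is at most the squared distance. For equality, translate so that `0` is a best scalar approximation.
It then suffices to find a unit vector attaining the norm of `A` at which every expectation `⟪x, A i
x⟫` vanishes (`exists_norm_attaining_of_minimal`). The norm-attaining unit vectors are those of the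
top eigenspace of `∑ i, A i⋆ A i`. If their joint expectations form a convex set missing `0`, that
set can be separated from `0`, and a small translation along the separating direction lowers the
norm, a contradiction.

The crux is this convexity, which fails for general tuples. On a subspace reducing a doubly
commuting tuple, `quadAdditive_of_doublyCommuting` proves it by splitting off pieces that behave
like tensor products: by Schur's lemma one operator acts on one factor and the remaining ones on the
other, so Toeplitz–Hausdorff on one side combines with induction on the other.

The top eigenspace need not reduce `A`, since `A j` need not commute with `A j⋆ A j`. Pinching each
`A j` by the spectral projections of `A j⋆ A j` gives a doubly commuting tuple that the eigenspace
does reduce, with the same quadratic forms there (`exists_doublyCommuting_reducing`). -/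

open scoped InnerProductSpace

/-! ### Toeplitz–Hausdorff in homogeneous form. -/

section NumericalRange

variable {E : Type*} [NormedAddCommGroup E] [InnerProductSpace ℂ E]

/-- The joint values `(‖x‖², ⟪x, B j x⟫)`, `j ∈ s`, taken on vectors `x ∈ V` are closed under
addition. This is the homogeneous form of convexity of the joint numerical range on `V`. -/
def QuadAdditive {ι : Type*} (s : Finset ι) (B : ι → E →L[ℂ] E) (V : Submodule ℂ E) : Prop :=
  ∀ x ∈ V, ∀ y ∈ V, ∃ w ∈ V, ‖w‖ ^ 2 = ‖x‖ ^ 2 + ‖y‖ ^ 2 ∧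
    ∀ j ∈ s, ⟪w, B j w⟫_ℂ = ⟪x, B j x⟫_ℂ + ⟪y, B j y⟫_ℂ

theorem QuadAdditive.exists_sum {ι κ : Type*} {s : Finset ι} {B : ι → E →L[ℂ] E}
    {V : Submodule ℂ E} (h : QuadAdditive s B V) (t : Finset κ) (x : κ → E) (hx : ∀ i ∈ t, x i ∈ V) :
    ∃ w ∈ V, ‖w‖ ^ 2 = ∑ i ∈ t, ‖x i‖ ^ 2 ∧
      ∀ j ∈ s, ⟪w, B j w⟫_ℂ = ∑ i ∈ t, ⟪x i, B j (x i)⟫_ℂ := by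
  classical
  induction t using Finset.induction_on with
  | empty => exact ⟨0, V.zero_mem, by simp, by simp⟩
  | insert a t ha ih =>
    obtain ⟨w, hw, hn, hq⟩ := ih fun i hi => hx i (Finset.mem_insert_of_mem hi)
    obtain ⟨w', hw', hn', hq'⟩ := h (x a) (hx a (Finset.mem_insert_self a t)) w hw
    refine ⟨w', hw', ?_, fun j hj => ?_⟩
    · rw [hn', hn, Finset.sum_insert ha]
    · rw [hq' j hj, hq j hj, Finset.sum_insert ha]

/-- Conjugating the second summand leaves the imaginary part of `z * (g - conj h)`, so a phase
rotating `g - conj h` onto the real axis works. It will make the cross terms of a quadratic form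
real. -/
theorem exists_norm_one_mul_sub_conj_im_eq_zero (g h : ℂ) :
    ∃ z : ℂ, ‖z‖ = 1 ∧ (z * g + starRingEnd ℂ z * h).im = 0 := by
  have key : ∀ z : ℂ, (z * g + starRingEnd ℂ z * h).im = (z * (g - starRingEnd ℂ h)).im := by
    intro z
    simp [Complex.mul_im, Complex.add_im]
    ring
  by_cases hk : g - starRingEnd ℂ h = 0
  · exact ⟨1, by simp, by rw [key, hk]; simp⟩
  · set k := g - starRingEnd ℂ h
    have hk' : (‖k‖ : ℂ) ≠ 0 := by simpa using hk
    refine ⟨starRingEnd ℂ k / ‖k‖, by simp [hk], ?_⟩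
    rw [key]
    have : starRingEnd ℂ k / ‖k‖ * k = (‖k‖ : ℂ) := by
      rw [div_mul_eq_mul_div, Complex.conj_mul', sq]
      field_simp
    rw [this, Complex.ofReal_im]

/-- Toeplitz–Hausdorff on the span of two unit vectors where the values are `0` and `1`. -/
theorem exists_inner_eq_of_inner_eq_zero_one (T : E →L[ℂ] E) {V : Submodule ℂ E} {x y : E}
    (hx : x ∈ V) (hy : y ∈ V) (hy1 : ‖y‖ = 1) (hx1 : ‖x‖ = 1)
    (hTx : ⟪x, T x⟫_ℂ = 0) (hTy : ⟪y, T y⟫_ℂ = 1) {t : ℝ} (ht0 : 0 ≤ t) (ht1 : t ≤ 1) :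
    ∃ w ∈ V, ‖w‖ = 1 ∧ ⟪w, T w⟫_ℂ = t := by
  obtain ⟨z, hz, hzi⟩ := exists_norm_one_mul_sub_conj_im_eq_zero ⟪x, T y⟫_ℂ ⟪y, T x⟫_ℂ
  have hzz : starRingEnd ℂ z * z = 1 := by rw [Complex.conj_mul', hz]; simp
  -- With `y` rotated by `z`, the form is real along the whole segment, so the intermediate value
  -- theorem yields a point where it equals `t * ‖w s‖ ^ 2`.
  let w : ℝ → E := fun s => ((1 - s : ℝ) : ℂ) • x + ((s : ℝ) : ℂ) • z • y
  have hwc : Continuous w := by fun_prop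
  have hq : ∀ s, ⟪w s, T (w s)⟫_ℂ =
      (((1 - s) * s : ℝ) : ℂ) * (z * ⟪x, T y⟫_ℂ + starRingEnd ℂ z * ⟪y, T x⟫_ℂ)
        + ((s ^ 2 : ℝ) : ℂ) := by
    intro s
    simp only [w, map_add, map_smul, inner_add_left, inner_add_right, inner_smul_left,
      inner_smul_right, hTx, hTy, Complex.conj_ofReal]
    push_cast
    linear_combination (s : ℂ) ^ 2 * hzz
  have him : ∀ s, (⟪w s, T (w s)⟫_ℂ).im = 0 := by
    intro s
    rw [hq, Complex.add_im, Complex.im_ofReal_mul, hzi, Complex.ofReal_im]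
    ring
  have hF : ContinuousOn (fun s => (⟪w s, T (w s)⟫_ℂ).re - t * ‖w s‖ ^ 2) (Set.Icc 0 1) := by
    have : Continuous (fun s => ⟪w s, T (w s)⟫_ℂ) := hwc.inner (T.continuous.comp hwc)
    exact ((Complex.continuous_re.comp this).sub (by fun_prop)).continuousOn
  have hzero : (0 : ℝ) ∈ (fun s => (⟪w s, T (w s)⟫_ℂ).re - t * ‖w s‖ ^ 2) '' Set.Icc 0 1 := by
    refine intermediate_value_Icc zero_le_one hF ⟨?_, ?_⟩
    · simp [w, hTx, hx1, ht0]
    · rw [hq]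
      simp [w, norm_smul, hz, hy1, ht1]
  obtain ⟨s, -, hs⟩ := hzero
  -- If the segment met `0`, comparing the values `0` at `x` and `1` at `y` would force `s = 0`,
  -- hence `x = 0`.
  have hw0 : w s ≠ 0 := by
    intro h0
    have h1 : ((1 - s : ℝ) : ℂ) • x = -(((s : ℝ) : ℂ) • z • y) := eq_neg_of_add_eq_zero_left h0
    have h2 := congrArg (fun v => ⟪v, T v⟫_ℂ) h1
    simp only [map_smul, map_neg, inner_neg_neg, inner_smul_left, inner_smul_right, hTx, hTy,
      Complex.conj_ofReal] at h2
    have h3 : (s : ℂ) ^ 2 = 0 := by linear_combination -h2 - (s : ℂ) ^ 2 * hzz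
    have h4 : s = 0 := by simpa using h3
    subst h4
    have : x = 0 := by simpa [w] using h0
    simp [this] at hx1
  have hn : (‖w s‖ : ℂ) ≠ 0 := by simpa using hw0
  refine ⟨((‖w s‖⁻¹ : ℝ) : ℂ) • w s, ?_, ?_, ?_⟩
  · exact V.smul_mem _ (V.add_mem (V.smul_mem _ hx) (V.smul_mem _ (V.smul_mem _ hy)))
  · rw [norm_smul, Complex.norm_real, norm_inv, norm_norm, inv_mul_cancel₀ (by simpa using hw0)]
  · have hval : ⟪w s, T (w s)⟫_ℂ = ((t * ‖w s‖ ^ 2 : ℝ) : ℂ) := by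
      apply Complex.ext
      · rw [Complex.ofReal_re]; linarith
      · rw [Complex.ofReal_im, him]
    rw [map_smul, inner_smul_left, inner_smul_right, hval, Complex.conj_ofReal]
    push_cast
    field_simp

/-- The Toeplitz–Hausdorff theorem for unit vectors of a subspace. -/
theorem exists_inner_eq_convexCombo (T : E →L[ℂ] E) {V : Submodule ℂ E} {x y : E}
    (hx : x ∈ V) (hy : y ∈ V) (hx1 : ‖x‖ = 1) (hy1 : ‖y‖ = 1) {t : ℝ} (ht0 : 0 ≤ t) (ht1 : t ≤ 1) :
    ∃ w ∈ V, ‖w‖ = 1 ∧ ⟪w, T w⟫_ℂ = (1 - t) * ⟪x, T x⟫_ℂ + t * ⟪y, T y⟫_ℂ := by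
  by_cases hab : ⟪y, T y⟫_ℂ - ⟪x, T x⟫_ℂ = 0
  · exact ⟨x, hx, hx1, by linear_combination -(t : ℂ) * hab⟩
  set a := ⟪x, T x⟫_ℂ with ha
  set b := ⟪y, T y⟫_ℂ with hb
  have hsub : ∀ v : E, ‖v‖ = 1 → ⟪v, ((b - a)⁻¹ • (T - a • ContinuousLinearMap.id ℂ E)) v⟫_ℂ =
      (b - a)⁻¹ * (⟪v, T v⟫_ℂ - a) := by
    intro v hv
    simp [hv]
  obtain ⟨w, hw, hw1, hq⟩ := exists_inner_eq_of_inner_eq_zero_one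
    ((b - a)⁻¹ • (T - a • ContinuousLinearMap.id ℂ E)) hx hy hy1 hx1
    (by rw [hsub x hx1, ← ha]; simp) (by rw [hsub y hy1, ← hb, inv_mul_cancel₀ hab]) ht0 ht1
  refine ⟨w, hw, hw1, ?_⟩
  rw [hsub w hw1] at hq
  field_simp at hq
  linear_combination hq

theorem norm_real_smul_sq (r : ℝ) (x : E) : ‖(r : ℂ) • x‖ ^ 2 = r ^ 2 * ‖x‖ ^ 2 := by
  rw [norm_smul, mul_pow, Complex.norm_real, Real.norm_eq_abs, sq_abs]

theorem inner_real_smul_apply (T : E →L[ℂ] E) (r : ℝ) (x : E) :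
    ⟪(r : ℂ) • x, T ((r : ℂ) • x)⟫_ℂ = ((r ^ 2 : ℝ) : ℂ) * ⟪x, T x⟫_ℂ := by
  rw [map_smul, inner_smul_left, inner_smul_right, Complex.conj_ofReal]
  push_cast
  ring

/-- Normalize both vectors, take the convex combination weighted by their squared norms, and
rescale. -/
theorem exists_inner_eq_add (T : E →L[ℂ] E) {V : Submodule ℂ E} {x y : E}
    (hx : x ∈ V) (hy : y ∈ V) :
    ∃ w ∈ V, ‖w‖ ^ 2 = ‖x‖ ^ 2 + ‖y‖ ^ 2 ∧ ⟪w, T w⟫_ℂ = ⟪x, T x⟫_ℂ + ⟪y, T y⟫_ℂ := by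
  by_cases hx0 : x = 0
  · exact ⟨y, hy, by simp [hx0], by simp [hx0]⟩
  by_cases hy0 : y = 0
  · exact ⟨x, hx, by simp [hy0], by simp [hy0]⟩
  have hxn : 0 < ‖x‖ := norm_pos_iff.mpr hx0
  have hyn : 0 < ‖y‖ := norm_pos_iff.mpr hy0
  have unit : ∀ v : E, 0 < ‖v‖ → ‖((‖v‖⁻¹ : ℝ) : ℂ) • v‖ = 1 := by
    intro v hv
    rw [norm_smul, Complex.norm_real, norm_inv, norm_norm, inv_mul_cancel₀ hv.ne']
  have hr : 0 < ‖x‖ ^ 2 + ‖y‖ ^ 2 := by positivity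
  obtain ⟨w, hw, hw1, hq⟩ := exists_inner_eq_convexCombo T
    (V.smul_mem ((‖x‖⁻¹ : ℝ) : ℂ) hx) (V.smul_mem ((‖y‖⁻¹ : ℝ) : ℂ) hy) (unit x hxn) (unit y hyn)
    (t := ‖y‖ ^ 2 / (‖x‖ ^ 2 + ‖y‖ ^ 2)) (by positivity)
    ((div_le_one hr).mpr (by nlinarith))
  refine ⟨((Real.sqrt (‖x‖ ^ 2 + ‖y‖ ^ 2) : ℝ) : ℂ) • w, V.smul_mem _ hw, ?_, ?_⟩
  · rw [norm_real_smul_sq, hw1, Real.sq_sqrt hr.le]; ring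
  · have h1 : (‖x‖ : ℂ) ≠ 0 := by exact_mod_cast hxn.ne'
    have h2 : (‖y‖ : ℂ) ≠ 0 := by exact_mod_cast hyn.ne'
    have h3 : (‖x‖ : ℂ) ^ 2 + (‖y‖ : ℂ) ^ 2 ≠ 0 := by exact_mod_cast hr.ne'
    rw [inner_real_smul_apply, hq, Real.sq_sqrt hr.le, inner_real_smul_apply,
      inner_real_smul_apply]
    push_cast
    field_simp
    ring

theorem quadAdditive_singleton {ι : Type*} (B : ι → E →L[ℂ] E) (a : ι) (V : Submodule ℂ E) :
    QuadAdditive {a} B V := by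
  intro x hx y hy
  obtain ⟨w, hw, hn, hq⟩ := exists_inner_eq_add (B a) hx hy
  refine ⟨w, hw, hn, fun j hj => ?_⟩
  rw [Finset.mem_singleton.mp hj]
  exact hq

theorem inner_self_eq_ofReal_norm_sq (x : E) : ⟪x, x⟫_ℂ = ((‖x‖ ^ 2 : ℝ) : ℂ) := by
  rw [inner_self_eq_norm_sq_to_K, Complex.ofReal_pow]
  rfl

theorem norm_sq_eq_sum_of_inner_self_eq {κ : Type*} [Fintype κ] {x : E} {y : κ → E}
    (h : ⟪x, x⟫_ℂ = ∑ i, ⟪y i, y i⟫_ℂ) : ‖x‖ ^ 2 = ∑ i, ‖y i‖ ^ 2 := by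
  simp only [inner_self_eq_ofReal_norm_sq] at h
  exact_mod_cast h

end NumericalRange

/-! ### Reducing subspaces and the tensor structure given by Schur's lemma. -/

section Reducing

variable {E : Type*} [NormedAddCommGroup E] [InnerProductSpace ℂ E] [CompleteSpace E]

/-- The operators for which `V` is a reducing subspace. -/
def reducedBy (V : Submodule ℂ E) : StarSubalgebra ℂ (E →L[ℂ] E) where
  carrier := {T | (∀ x ∈ V, T x ∈ V) ∧ ∀ x ∈ V, star T x ∈ V}
  mul_mem' := by
    rintro a b ⟨ha, ha'⟩ ⟨hb, hb'⟩
    refine ⟨fun x hx => ha _ (hb x hx), fun x hx => ?_⟩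
    rw [star_mul]
    exact hb' _ (ha' x hx)
  add_mem' := by
    rintro a b ⟨ha, ha'⟩ ⟨hb, hb'⟩
    refine ⟨fun x hx => V.add_mem (ha x hx) (hb x hx), fun x hx => ?_⟩
    rw [star_add]
    exact V.add_mem (ha' x hx) (hb' x hx)
  algebraMap_mem' := by
    intro r
    have key : ∀ r : ℂ, ∀ x ∈ V, (algebraMap ℂ (E →L[ℂ] E) r) x ∈ V := by
      intro r x hx
      rw [Algebra.algebraMap_eq_smul_one]
      exact V.smul_mem r hx
    refine ⟨key r, fun x hx => ?_⟩
    rw [← algebraMap_star_comm]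
    exact key _ x hx
  star_mem' := by
    rintro a ⟨ha, ha'⟩
    exact ⟨ha', by rwa [star_star]⟩

theorem inner_apply_eq_inner_star (T : E →L[ℂ] E) (x y : E) : ⟪x, T y⟫_ℂ = ⟪star T x, y⟫_ℂ := by
  rw [ContinuousLinearMap.star_eq_adjoint, ContinuousLinearMap.adjoint_inner_left]

theorem inner_star_apply_eq_inner (T : E →L[ℂ] E) (x y : E) : ⟪x, star T y⟫_ℂ = ⟪T x, y⟫_ℂ := by
  rw [ContinuousLinearMap.star_eq_adjoint, ContinuousLinearMap.adjoint_inner_right]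

theorem mem_reducedBy_orthogonal {V : Submodule ℂ E} {T : E →L[ℂ] E} (h : T ∈ reducedBy V) :
    T ∈ reducedBy Vᗮ := by
  refine ⟨fun x hx => ?_, fun x hx => ?_⟩
  · rw [Submodule.mem_orthogonal] at hx ⊢
    intro u hu
    rw [inner_apply_eq_inner_star]
    exact hx _ (h.2 u hu)
  · rw [Submodule.mem_orthogonal] at hx ⊢
    intro u hu
    rw [inner_star_apply_eq_inner]
    exact hx _ (h.1 u hu)

theorem mem_reducedBy_inf {V W : Submodule ℂ E} {T : E →L[ℂ] E} (hV : T ∈ reducedBy V)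
    (hW : T ∈ reducedBy W) : T ∈ reducedBy (V ⊓ W) :=
  ⟨fun x hx => ⟨hV.1 x hx.1, hW.1 x hx.2⟩, fun x hx => ⟨hV.2 x hx.1, hW.2 x hx.2⟩⟩

/-- The span of the vectors `c u` with `c ∈ C` and `u ∈ U`. -/
def algSpan (C : StarSubalgebra ℂ (E →L[ℂ] E)) (U : Submodule ℂ E) : Submodule ℂ E :=
  Submodule.span ℂ {x | ∃ c ∈ C, ∃ u ∈ U, x = c u}

/-- One coefficient in `C` per basis vector suffices, because the coordinates of `u` can be absorbed
into `C`. -/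
theorem exists_eq_sum_of_mem_algSpan {C : StarSubalgebra ℂ (E →L[ℂ] E)} {U : Submodule ℂ E}
    {κ : Type*} [Fintype κ] (b : OrthonormalBasis κ ℂ U) {x : E} (hx : x ∈ algSpan C U) :
    ∃ c : κ → E →L[ℂ] E, (∀ i, c i ∈ C) ∧ x = ∑ i, c i (b i) := by
  induction hx using Submodule.span_induction with
  | mem x h =>
    obtain ⟨c, hc, u, hu, rfl⟩ := h
    refine ⟨fun i => ⟪b i, (⟨u, hu⟩ : U)⟫_ℂ • c, fun i => C.smul_mem hc _, ?_⟩
    have h1 := congrArg (fun v : U => c (v : E)) (b.sum_repr' ⟨u, hu⟩)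
    simp only [Submodule.coe_sum, map_sum, Submodule.coe_smul, map_smul] at h1
    exact h1.symm
  | zero => exact ⟨0, fun i => C.zero_mem, by simp⟩
  | add x y _ _ hx hy =>
    obtain ⟨c, hc, rfl⟩ := hx
    obtain ⟨c', hc', rfl⟩ := hy
    exact ⟨c + c', fun i => C.add_mem (hc i) (hc' i), by simp [Finset.sum_add_distrib]⟩
  | smul r x _ hx =>
    obtain ⟨c, hc, rfl⟩ := hx
    exact ⟨r • c, fun i => C.smul_mem (hc i) r, by simp [Finset.smul_sum]⟩

theorem map_mem_algSpan {C : StarSubalgebra ℂ (E →L[ℂ] E)} {U : Submodule ℂ E} {S : E →L[ℂ] E}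
    (h : ∀ c ∈ C, ∀ u ∈ U, S (c u) ∈ algSpan C U) {x : E} (hx : x ∈ algSpan C U) :
    S x ∈ algSpan C U := by
  have : algSpan C U ≤ (algSpan C U).comap (S : E →ₗ[ℂ] E) := by
    refine Submodule.span_le.mpr ?_
    rintro _ ⟨c, hc, u, hu, rfl⟩
    exact h c hc u hu
  exact this hx

theorem mem_reducedBy_algSpan_of_mem {C : StarSubalgebra ℂ (E →L[ℂ] E)} {U : Submodule ℂ E}
    {a : E →L[ℂ] E} (ha : a ∈ C) : a ∈ reducedBy (algSpan C U) :=
  ⟨fun _ => map_mem_algSpan fun c hc u hu =>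
      Submodule.subset_span ⟨a * c, mul_mem ha hc, u, hu, rfl⟩,
    fun _ => map_mem_algSpan fun c hc u hu =>
      Submodule.subset_span ⟨star a * c, mul_mem (star_mem ha) hc, u, hu, rfl⟩⟩

theorem mem_reducedBy_algSpan_of_commute {C : StarSubalgebra ℂ (E →L[ℂ] E)} {U : Submodule ℂ E}
    {T : E →L[ℂ] E} (hC : C ≤ StarSubalgebra.centralizer ℂ {T}) (hT : T ∈ reducedBy U) :
    T ∈ reducedBy (algSpan C U) := by
  have hcom : ∀ c ∈ C, T * c = c * T ∧ star T * c = c * star T := fun c hc =>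
    StarSubalgebra.mem_centralizer_iff ℂ |>.mp (hC hc) T rfl
  refine ⟨fun _ => map_mem_algSpan fun c hc u hu => Submodule.subset_span ⟨c, hc, T u, hT.1 u hu,
      congrArg (fun S => S u) (hcom c hc).1⟩,
    fun _ => map_mem_algSpan fun c hc u hu => Submodule.subset_span ⟨c, hc, star T u, hT.2 u hu,
      congrArg (fun S => S u) (hcom c hc).2⟩⟩

/-- The cyclic subspace `C e`. -/
def cyclic (C : StarSubalgebra ℂ (E →L[ℂ] E)) (e : E) : Submodule ℂ E where
  carrier := {x | ∃ c ∈ C, x = c e}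
  add_mem' := by
    rintro _ _ ⟨a, ha, rfl⟩ ⟨b, hb, rfl⟩
    exact ⟨a + b, add_mem ha hb, rfl⟩
  zero_mem' := ⟨0, zero_mem C, rfl⟩
  smul_mem' := by
    rintro r _ ⟨a, ha, rfl⟩
    exact ⟨r • a, C.smul_mem ha r, rfl⟩

theorem mem_reducedBy_cyclic {C : StarSubalgebra ℂ (E →L[ℂ] E)} {e : E} {a : E →L[ℂ] E}
    (ha : a ∈ C) : a ∈ reducedBy (cyclic C e) := by
  refine ⟨?_, ?_⟩
  · rintro _ ⟨c, hc, rfl⟩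
    exact ⟨a * c, mul_mem ha hc, rfl⟩
  · rintro _ ⟨c, hc, rfl⟩
    exact ⟨star a * c, mul_mem (star_mem ha) hc, rfl⟩

variable [FiniteDimensional ℂ E]

theorem exists_minimal_reducing (T : E →L[ℂ] E) {V : Submodule ℂ E} (hV : V ≠ ⊥)
    (hT : T ∈ reducedBy V) :
    ∃ U ≤ V, U ≠ ⊥ ∧ T ∈ reducedBy U ∧ ∀ U' ≤ U, U' ≠ ⊥ → T ∈ reducedBy U' → U' = U := by
  obtain ⟨U, hU, hmin⟩ := (wellFounded_lt (α := Submodule ℂ E)).has_min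
    {U | U ≤ V ∧ U ≠ ⊥ ∧ T ∈ reducedBy U} ⟨V, le_rfl, hV, hT⟩
  refine ⟨U, hU.1, hU.2.1, hU.2.2, fun U' hle hne hred => ?_⟩
  by_contra hc
  exact hmin U' ⟨hle.trans hU.1, hne, hred⟩ (lt_of_le_of_ne hle hc)

/-- Schur's lemma: the compression to an irreducible subspace of an operator commuting with `T`
and its adjoint is a scalar. -/
theorem exists_inner_apply_eq_smul_of_minimal {T c : E →L[ℂ] E} {U : Submodule ℂ E} (hU : U ≠ ⊥)
    (hT : T ∈ reducedBy U) (hmin : ∀ U' ≤ U, U' ≠ ⊥ → T ∈ reducedBy U' → U' = U)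
    (hc : T * c = c * T) (hc' : star T * c = c * star T) :
    ∃ ω : ℂ, ∀ u ∈ U, ∀ v ∈ U, ⟪u, c v⟫_ℂ = ω * ⟪u, v⟫_ℂ := by
  have : Nontrivial U := Submodule.nontrivial_iff_ne_bot.mpr hU
  let D : U →ₗ[ℂ] U := (U.orthogonalProjectionOnto : E →ₗ[ℂ] U) ∘ₗ (c : E →ₗ[ℂ] E) ∘ₗ U.subtype
  obtain ⟨ω, hω⟩ := Module.End.exists_eigenvalue D
  obtain ⟨e, he, he0⟩ := hω.exists_hasEigenvector
  rw [Module.End.mem_eigenspace_iff] at he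
  -- An eigenspace of the compression `D`, viewed in `E`. It reduces `T` because `c` commutes with
  -- `T` and its adjoint, so minimality makes it all of `U`.
  let U' : Submodule ℂ E :=
    { carrier := {v | v ∈ U ∧ ∀ u ∈ U, ⟪u, c v⟫_ℂ = ω * ⟪u, v⟫_ℂ}
      add_mem' := by
        rintro a b ⟨ha, ha'⟩ ⟨hb, hb'⟩
        refine ⟨U.add_mem ha hb, fun u hu => ?_⟩
        rw [map_add, inner_add_right, inner_add_right, ha' u hu, hb' u hu, mul_add]
      zero_mem' := ⟨U.zero_mem, fun u _ => by simp⟩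
      smul_mem' := by
        rintro r a ⟨ha, ha'⟩
        refine ⟨U.smul_mem r ha, fun u hu => ?_⟩
        rw [map_smul, inner_smul_right, inner_smul_right, ha' u hu]
        ring }
  have hcT : ∀ v, c (T v) = T (c v) := fun v => (congrArg (fun S => S v) hc).symm
  have hcT' : ∀ v, c (star T v) = star T (c v) := fun v => (congrArg (fun S => S v) hc').symm
  have hU' : U' = U := by
    refine hmin U' (fun v hv => hv.1) ?_ ⟨?_, ?_⟩
    · refine (Submodule.ne_bot_iff _).mpr ⟨e, ⟨e.2, fun u hu => ?_⟩, by simpa using he0⟩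
      have h1 := congrArg (fun v : U => ⟪(⟨u, hu⟩ : U), v⟫_ℂ) he
      simpa [D, inner_smul_right] using h1
    · rintro v ⟨hv, hv'⟩
      refine ⟨hT.1 v hv, fun u hu => ?_⟩
      rw [hcT, inner_apply_eq_inner_star, hv' _ (hT.2 u hu), inner_apply_eq_inner_star T u v]
    · rintro v ⟨hv, hv'⟩
      refine ⟨hT.2 v hv, fun u hu => ?_⟩
      rw [hcT', inner_star_apply_eq_inner, hv' _ (hT.1 u hu), inner_star_apply_eq_inner T u v]
  refine ⟨ω, fun u hu v hv => ?_⟩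
  rw [← hU'] at hv
  exact hv.2 u hu

/-- Vectors `c u`, with `u` in a `T`-irreducible subspace and `c` commuting with `T` and its
adjoint, pair like elementary tensors. -/
theorem inner_apply_apply_of_minimal {T : E →L[ℂ] E} {U : Submodule ℂ E} (hU : U ≠ ⊥)
    (hT : T ∈ reducedBy U) (hmin : ∀ U' ≤ U, U' ≠ ⊥ → T ∈ reducedBy U' → U' = U)
    {e : E} (he : e ∈ U) (he1 : ‖e‖ = 1) {a b : E →L[ℂ] E}
    (ha : a ∈ StarSubalgebra.centralizer ℂ {T}) (hb : b ∈ StarSubalgebra.centralizer ℂ {T})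
    {u v : E} (hu : u ∈ U) (hv : v ∈ U) : ⟪a u, b v⟫_ℂ = ⟪a e, b e⟫_ℂ * ⟪u, v⟫_ℂ := by
  have hc := StarSubalgebra.mem_centralizer_iff ℂ |>.mp (mul_mem (star_mem ha) hb) T rfl
  obtain ⟨ω, hω⟩ := exists_inner_apply_eq_smul_of_minimal hU hT hmin hc.1 hc.2
  have key : ∀ x y, ⟪a x, b y⟫_ℂ = ⟪x, (star a * b) y⟫_ℂ := fun x y =>
    (inner_star_apply_eq_inner a x (b y)).symm
  rw [key, key, hω u hu v hv, hω e he e he, inner_self_eq_norm_sq_to_K, he1]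
  simp

/-- If `C` commutes with `T`, and `U` is `T`-irreducible, the joint numerical values on `C U` split
into values of `C` on a cyclic subspace `C e` and of `T` on `U`. -/
theorem exists_split_of_mem_algSpan {T : E →L[ℂ] E} {U : Submodule ℂ E} (hU : U ≠ ⊥)
    (hT : T ∈ reducedBy U) (hmin : ∀ U' ≤ U, U' ≠ ⊥ → T ∈ reducedBy U' → U' = U)
    {e : E} (he : e ∈ U) (he1 : ‖e‖ = 1) {C : StarSubalgebra ℂ (E →L[ℂ] E)}
    (hC : C ≤ StarSubalgebra.centralizer ℂ {T}) {x : E} (hx : x ∈ algSpan C U) :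
    ∃ (p : Fin (Module.finrank ℂ U) → E) (v : Fin (Module.finrank ℂ E) → E),
      (∀ i, p i ∈ cyclic C e) ∧ (∀ m, v m ∈ U) ∧
      (∀ a ∈ C, ⟪x, a x⟫_ℂ = ∑ i, ⟪p i, a (p i)⟫_ℂ) ∧
      ⟪x, T x⟫_ℂ = ∑ m, ⟪v m, T (v m)⟫_ℂ ∧ ‖x‖ ^ 2 = ∑ i, ‖p i‖ ^ 2 ∧ ‖x‖ ^ 2 = ∑ m, ‖v m‖ ^ 2 := by
  let b := stdOrthonormalBasis ℂ U
  let f := stdOrthonormalBasis ℂ E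
  obtain ⟨c, hc, rfl⟩ := exists_eq_sum_of_mem_algSpan b hx
  have hbU : ∀ i, (b i : E) ∈ U := fun i => (b i).2
  have horth : ∀ i k, ⟪(b i : E), (b k : E)⟫_ℂ = if i = k then 1 else 0 := fun i k => by
    rw [← Submodule.coe_inner]
    exact orthonormal_iff_ite.mp b.orthonormal i k
  -- Read `x` as the tensor `∑ i, c i e ⊗ b i`. Slicing its first factor along the basis `f` gives
  -- the vectors in `U`; slicing the second along `b` gives the vectors `c i e`.
  have hpair : ∀ S : E →L[ℂ] E, S ∈ reducedBy U → (∀ i, S * c i = c i * S) →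
      ⟪∑ i, c i (b i), S (∑ i, c i (b i))⟫_ℂ =
        ∑ m, ⟪∑ i, ⟪f m, c i e⟫_ℂ • (b i : E), S (∑ i, ⟪f m, c i e⟫_ℂ • (b i : E))⟫_ℂ := by
    intro S hS hcom
    have hcS : ∀ i v, S (c i v) = c i (S v) := fun i v => congrArg (fun R => R v) (hcom i)
    simp only [map_sum, sum_inner, inner_sum, map_smul, inner_smul_left, inner_smul_right]
    conv_rhs => rw [Finset.sum_comm]
    refine Finset.sum_congr rfl fun k _ => ?_
    simp_rw [Finset.mul_sum]
    conv_rhs => rw [Finset.sum_comm]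
    refine Finset.sum_congr rfl fun i _ => ?_
    rw [hcS, inner_apply_apply_of_minimal hU hT hmin he he1 (hC (hc _)) (hC (hc _)) (hbU _)
      (hS.1 _ (hbU _)), ← f.sum_inner_mul_inner, Finset.sum_mul]
    refine Finset.sum_congr rfl fun m _ => ?_
    rw [inner_conj_symm]
    ring
  have hcyc : ∀ a ∈ C, ⟪∑ i, c i (b i), a (∑ i, c i (b i))⟫_ℂ = ∑ i, ⟪c i e, a (c i e)⟫_ℂ := by
    intro a ha
    simp only [map_sum, sum_inner, inner_sum]
    refine Finset.sum_congr rfl fun i _ => ?_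
    have h1 : ∀ k, ⟪c k (b k), a (c i (b i))⟫_ℂ = ⟪c k e, a (c i e)⟫_ℂ * if k = i then 1 else 0 :=
      fun k => by
        rw [← horth]
        exact inner_apply_apply_of_minimal hU hT hmin he he1 (hC (hc k))
          (hC (mul_mem ha (hc i))) (hbU k) (hbU i)
    simp [h1]
  exact ⟨fun i => c i e, fun m => ∑ i, ⟪f m, c i e⟫_ℂ • (b i : E), fun i => ⟨c i, hc i, rfl⟩,
    fun m => U.sum_mem fun i _ => U.smul_mem _ (hbU i), hcyc,
    hpair T hT fun i => (StarSubalgebra.mem_centralizer_iff ℂ |>.mp (hC (hc i)) T rfl).1,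
    norm_sq_eq_sum_of_inner_self_eq (hcyc 1 (one_mem C)),
    norm_sq_eq_sum_of_inner_self_eq (hpair 1 (one_mem _) fun i => by simp)⟩

end Reducing

/-! ### Convexity on reducing subspaces. -/

section Convexity

variable {E : Type*} [NormedAddCommGroup E] [InnerProductSpace ℂ E] [CompleteSpace E]
  [FiniteDimensional ℂ E]

/-- The joint numerical values on `C U` are closed under addition, if those on the cyclic subspace
`C e` are. -/
theorem quadAdditive_algSpan {ι : Type*} [DecidableEq ι] {B : ι → E →L[ℂ] E} {s : Finset ι} {a : ι}
    {U : Submodule ℂ E} (hU : U ≠ ⊥) (hT : B a ∈ reducedBy U)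
    (hmin : ∀ U' ≤ U, U' ≠ ⊥ → B a ∈ reducedBy U' → U' = U)
    {e : E} (he : e ∈ U) (he1 : ‖e‖ = 1) {C : StarSubalgebra ℂ (E →L[ℂ] E)}
    (hC : C ≤ StarSubalgebra.centralizer ℂ {B a}) (hs : ∀ j ∈ s, B j ∈ C)
    (hadd : QuadAdditive s B (cyclic C e)) : QuadAdditive (insert a s) B (algSpan C U) := by
  intro x hx y hy
  obtain ⟨p, v, hp, hv, hpq, hvq, hpn, hvn⟩ :=
    exists_split_of_mem_algSpan hU hT hmin he he1 hC hx
  obtain ⟨p', v', hp', hv', hpq', hvq', hpn', hvn'⟩ :=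
    exists_split_of_mem_algSpan hU hT hmin he he1 hC hy
  obtain ⟨_, ⟨c, hc, rfl⟩, hcn, hcq⟩ := hadd.exists_sum Finset.univ (Sum.elim p p')
    (by rintro (i | i) - <;> simp [hp, hp'])
  obtain ⟨u, hu, hun, huq⟩ := (quadAdditive_singleton B a U).exists_sum Finset.univ (Sum.elim v v')
    (by rintro (i | i) - <;> simp [hv, hv'])
  simp only [Fintype.sum_sum_type, Sum.elim_inl, Sum.elim_inr, ← hpn, ← hpn', ← hvn, ← hvn']
    at hcn hun
  have huq := huq a (Finset.mem_singleton_self a)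
  simp only [Fintype.sum_sum_type, Sum.elim_inl, Sum.elim_inr, ← hvq, ← hvq'] at huq
  rcases eq_or_ne u 0 with hu0 | hu0
  · have h0 : ‖x‖ ^ 2 + ‖y‖ ^ 2 = 0 := by rw [← hun, hu0]; simp
    have hx0 : x = 0 := by
      rw [← norm_eq_zero, ← sq_eq_zero_iff]; nlinarith [sq_nonneg ‖x‖, sq_nonneg ‖y‖]
    have hy0 : y = 0 := by
      rw [← norm_eq_zero, ← sq_eq_zero_iff]; nlinarith [sq_nonneg ‖x‖, sq_nonneg ‖y‖]
    exact ⟨0, Submodule.zero_mem _, by simp [hx0, hy0], by simp [hx0, hy0]⟩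
  have hu1 : ‖u‖ ≠ 0 := norm_ne_zero_iff.mpr hu0
  have hu1' : (‖u‖ : ℂ) ≠ 0 := by exact_mod_cast hu1
  have huu : ⟪u, u⟫_ℂ = (‖u‖ : ℂ) ^ 2 := by
    rw [inner_self_eq_ofReal_norm_sq]
    push_cast
    rfl
  have hee : ⟪c e, c e⟫_ℂ = (‖u‖ : ℂ) ^ 2 := by
    rw [inner_self_eq_ofReal_norm_sq, hcn.trans hun.symm]
    push_cast
    rfl
  have hcu : ∀ b ∈ C, ⟪c u, b (c u)⟫_ℂ = ⟪c e, b (c e)⟫_ℂ * (‖u‖ : ℂ) ^ 2 := fun b hb => by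
    rw [← huu]
    exact inner_apply_apply_of_minimal hU hT hmin he he1 (hC hc) (hC (mul_mem hb hc)) hu hu
  have hcu1 : ‖c u‖ ^ 2 = ‖u‖ ^ 2 * ‖u‖ ^ 2 := by
    have h1 := hcu 1 (one_mem C)
    simp only [one_apply_eq_self, hee, inner_self_eq_ofReal_norm_sq] at h1
    exact_mod_cast h1
  -- `c u` plays the role of `c e ⊗ u`. Both factors have squared norm `‖x‖ ^ 2 + ‖y‖ ^ 2`, so
  -- dividing by `‖u‖` restores the required norm.
  refine ⟨((‖u‖⁻¹ : ℝ) : ℂ) • c u,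
    Submodule.smul_mem _ _ (Submodule.subset_span ⟨c, hc, u, hu, rfl⟩), ?_, fun j hj => ?_⟩
  · rw [norm_real_smul_sq, hcu1, ← hun]
    field_simp
  rw [inner_real_smul_apply]
  rcases Finset.mem_insert.mp hj with rfl | hj
  · have hcom := (StarSubalgebra.mem_centralizer_iff ℂ |>.mp (hC hc) _ rfl).1
    have h1 : B j (c u) = c (B j u) := congrArg (fun S => S u) hcom
    rw [h1, inner_apply_apply_of_minimal hU hT hmin he he1 (hC hc) (hC hc) hu (hT.1 u hu), hee,
      huq]
    push_cast
    field_simp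
  · rw [hcu _ (hs j hj), hcq j hj, Fintype.sum_sum_type, hpq _ (hs j hj), hpq' _ (hs j hj)]
    simp only [Sum.elim_inl, Sum.elim_inr]
    push_cast
    field_simp

/-- Cross terms between `W` and its complement vanish, so the two summands can be treated separately
and the results added. -/
theorem QuadAdditive.of_orthogonal {ι : Type*} {B : ι → E →L[ℂ] E} {s : Finset ι}
    {V W : Submodule ℂ E} (hle : W ≤ V) (hW : ∀ j ∈ s, B j ∈ reducedBy W)
    (h1 : QuadAdditive s B W) (h2 : QuadAdditive s B (V ⊓ Wᗮ)) : QuadAdditive s B V := by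
  have hdec : ∀ x ∈ V, ∃ x₁ ∈ W, ∃ x₂ ∈ V ⊓ Wᗮ, x = x₁ + x₂ := by
    intro x hx
    obtain ⟨x₁, h₁, x₂, h₂, rfl⟩ := W.exists_add_mem_mem_orthogonal x
    exact ⟨x₁, h₁, x₂, ⟨by simpa using V.sub_mem hx (hle h₁), h₂⟩, rfl⟩
  have hnorm : ∀ x₁ ∈ W, ∀ x₂ ∈ V ⊓ Wᗮ, ‖x₁ + x₂‖ ^ 2 = ‖x₁‖ ^ 2 + ‖x₂‖ ^ 2 := by
    intro x₁ h₁ x₂ h₂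
    have := norm_add_sq_eq_norm_sq_add_norm_sq_of_inner_eq_zero (𝕜 := ℂ) x₁ x₂ (h₂.2 x₁ h₁)
    simpa [sq] using this
  have hinner : ∀ j ∈ s, ∀ x₁ ∈ W, ∀ x₂ ∈ V ⊓ Wᗮ,
      ⟪x₁ + x₂, B j (x₁ + x₂)⟫_ℂ = ⟪x₁, B j x₁⟫_ℂ + ⟪x₂, B j x₂⟫_ℂ := by
    intro j hj x₁ h₁ x₂ h₂
    have e1 : ⟪x₁, B j x₂⟫_ℂ = 0 := (mem_reducedBy_orthogonal (hW j hj)).1 x₂ h₂.2 x₁ h₁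
    have e2 : ⟪x₂, B j x₁⟫_ℂ = 0 :=
      Submodule.inner_left_of_mem_orthogonal ((hW j hj).1 x₁ h₁) h₂.2
    rw [map_add, inner_add_left, inner_add_right, inner_add_right, e1, e2]
    ring
  intro x hx y hy
  obtain ⟨x₁, hx₁, x₂, hx₂, rfl⟩ := hdec x hx
  obtain ⟨y₁, hy₁, y₂, hy₂, rfl⟩ := hdec y hy
  obtain ⟨w₁, hw₁, hn₁, hq₁⟩ := h1 x₁ hx₁ y₁ hy₁
  obtain ⟨w₂, hw₂, hn₂, hq₂⟩ := h2 x₂ hx₂ y₂ hy₂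
  refine ⟨w₁ + w₂, V.add_mem (hle hw₁) hw₂.1, ?_, fun j hj => ?_⟩
  · rw [hnorm _ hw₁ _ hw₂, hnorm _ hx₁ _ hx₂, hnorm _ hy₁ _ hy₂, hn₁, hn₂]
    ring
  · rw [hinner j hj _ hw₁ _ hw₂, hinner j hj _ hx₁ _ hx₂, hinner j hj _ hy₁ _ hy₂, hq₁ j hj,
      hq₂ j hj]
    ring

/-- The joint numerical range of a doubly commuting tuple is convex on every reducing subspace. -/
theorem quadAdditive_of_doublyCommuting {ι : Type*} [DecidableEq ι] (B : ι → E →L[ℂ] E)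
    (hB : ∀ i j, i ≠ j → B i * B j = B j * B i ∧ star (B i) * B j = B j * star (B i))
    (s : Finset ι) (V : Submodule ℂ E) (hV : ∀ j ∈ s, B j ∈ reducedBy V) :
    QuadAdditive s B V := by
  induction s using Finset.induction_on generalizing V with
  | empty =>
    intro x hx y hy
    obtain ⟨w, hw, hn, -⟩ := exists_inner_eq_add (0 : E →L[ℂ] E) hx hy
    exact ⟨w, hw, hn, by simp⟩
  | insert a s ha ih =>
    -- The outer hypothesis handles `s` on a cyclic subspace; this inner induction on dimension
    -- handles what remains of `V` after `C U` is split off.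
    induction hd : Module.finrank ℂ V using Nat.strong_induction_on generalizing V with
    | _ d ihd =>
    subst hd
    rcases eq_or_ne V ⊥ with rfl | hne
    · intro x hx y hy
      rw [Submodule.mem_bot] at hx hy
      exact ⟨0, Submodule.zero_mem _, by simp [hx, hy], by simp [hx, hy]⟩
    have hTV := hV a (Finset.mem_insert_self a s)
    obtain ⟨U, hUV, hU, hT, hmin⟩ := exists_minimal_reducing (B a) hne hTV
    obtain ⟨e₀, he₀, hne₀⟩ := U.ne_bot_iff.mp hU
    have hpos : ‖e₀‖ ≠ 0 := norm_ne_zero_iff.mpr hne₀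
    have he : ((‖e₀‖⁻¹ : ℝ) : ℂ) • e₀ ∈ U := U.smul_mem _ he₀
    have he1 : ‖((‖e₀‖⁻¹ : ℝ) : ℂ) • e₀‖ = 1 := by
      rw [norm_smul, Complex.norm_real, norm_inv, norm_norm, inv_mul_cancel₀ hpos]
    set e := ((‖e₀‖⁻¹ : ℝ) : ℂ) • e₀
    -- The first factor keeps `C U` inside `V`; the second makes Schur's lemma applicable.
    let C := reducedBy V ⊓ StarSubalgebra.centralizer ℂ {B a}
    have hC : C ≤ StarSubalgebra.centralizer ℂ {B a} := inf_le_right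
    have hs : ∀ j ∈ s, B j ∈ C := fun j hj =>
      ⟨hV j (Finset.mem_insert_of_mem hj), StarSubalgebra.mem_centralizer_iff ℂ |>.mpr <| by
        rintro _ rfl
        exact hB a j fun h => ha (h ▸ hj)⟩
    have hle : algSpan C U ≤ V := by
      refine Submodule.span_le.mpr ?_
      rintro _ ⟨c, hc, u, hu, rfl⟩
      exact hc.1.1 u (hUV hu)
    have hred : ∀ j ∈ insert a s, B j ∈ reducedBy (algSpan C U) := by
      intro j hj
      rcases Finset.mem_insert.mp hj with rfl | hj
      · exact mem_reducedBy_algSpan_of_commute hC hT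
      · exact mem_reducedBy_algSpan_of_mem (hs j hj)
    refine QuadAdditive.of_orthogonal hle hred
      (quadAdditive_algSpan hU hT hmin he he1 hC hs
        (ih _ fun j hj => mem_reducedBy_cyclic (hs j hj)))
      (ihd _ ?_ _ (fun j hj => mem_reducedBy_inf (hV j hj)
        (mem_reducedBy_orthogonal (hred j hj))) rfl)
    refine Submodule.finrank_lt_finrank_of_lt (lt_of_le_of_ne inf_le_left fun heq => ?_)
    have hemem : e ∈ algSpan C U := Submodule.subset_span ⟨1, one_mem C, e, he, rfl⟩
    have hperp : e ∈ V ⊓ (algSpan C U)ᗮ := heq.ge (hUV he)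
    have : ⟪e, e⟫_ℂ = 0 := hperp.2 e hemem
    rw [inner_self_eq_zero] at this
    simp [this] at he1

end Convexity

/-! ### Pinching to make the eigenspace reducing. -/

section Pinching

variable {E : Type*} [NormedAddCommGroup E] [InnerProductSpace ℂ E]

/-- The pinching `∑ t, Q t * T * Q t`. -/
def pinch {κ : Type*} [Fintype κ] (Q : κ → E →L[ℂ] E) (T : E →L[ℂ] E) : E →L[ℂ] E :=
  ∑ t, Q t * T * Q t

theorem Commute.pinch_right {κ : Type*} [Fintype κ] {Q : κ → E →L[ℂ] E} {T X : E →L[ℂ] E}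
    (hQ : ∀ t, Commute X (Q t)) (hT : Commute X T) : Commute X (pinch Q T) :=
  Commute.sum_right _ _ _ fun t _ => ((hQ t).mul_right hT).mul_right (hQ t)

variable [CompleteSpace E]

theorem star_pinch {κ : Type*} [Fintype κ] {Q : κ → E →L[ℂ] E} (hQ : ∀ t, IsSelfAdjoint (Q t))
    (T : E →L[ℂ] E) : star (pinch Q T) = pinch Q (star T) := by
  simp only [pinch, star_sum, star_mul, (hQ _).star_eq, mul_assoc]

theorem mem_reducedBy_eigenspace_of_commute {S c : E →L[ℂ] E} (hS : IsSelfAdjoint S)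
    (hc : Commute c S) (μ : ℂ) :
    c ∈ reducedBy (Module.End.eigenspace (S : E →ₗ[ℂ] E) μ) := by
  have key : ∀ a : E →L[ℂ] E, Commute a S → ∀ x ∈ Module.End.eigenspace (S : E →ₗ[ℂ] E) μ,
      a x ∈ Module.End.eigenspace (S : E →ₗ[ℂ] E) μ := by
    intro a ha x hx
    rw [Module.End.mem_eigenspace_iff, ContinuousLinearMap.coe_coe] at hx ⊢
    have h1 : a (S x) = S (a x) := congrArg (fun R => R x) ha.eq
    rw [← h1, hx, map_smul]
  refine ⟨key c hc, key (star c) ?_⟩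
  have := hc.star_star
  rwa [hS.star_eq] at this

variable [FiniteDimensional ℂ E]

theorem commute_starProjection_of_mem_reducedBy {V : Submodule ℂ E} {c : E →L[ℂ] E}
    (h : c ∈ reducedBy V) : Commute c V.starProjection := by
  ext x
  obtain ⟨v, hv, v', hv', rfl⟩ := V.exists_add_mem_mem_orthogonal x
  have h1 := h.1 v hv
  have h2 := (mem_reducedBy_orthogonal h).1 v' hv'
  simp [Submodule.starProjection_eq_self_iff.mpr hv, Submodule.starProjection_eq_self_iff.mpr h1,
    (Submodule.starProjection_apply_eq_zero_iff V).mpr hv',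
    (Submodule.starProjection_apply_eq_zero_iff V).mpr h2]

/-- A self-adjoint operator has a resolution of the identity by spectral projections, which commute
with everything the operator commutes with. -/
theorem exists_spectral_resolution {S : E →L[ℂ] E} (hS : IsSelfAdjoint S) :
    ∃ (κ : Type) (_ : Fintype κ) (Q : κ → E →L[ℂ] E) (μ : κ → ℂ),
      ∑ t, Q t = 1 ∧ (∀ t, IsSelfAdjoint (Q t)) ∧ Function.Injective μ ∧
      (∀ t, starRingEnd ℂ (μ t) = μ t) ∧ (∀ t, S * Q t = μ t • Q t) ∧
      ∀ c, Commute c S → ∀ t, Commute c (Q t) := by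
  have hsym : (S : E →ₗ[ℂ] E).IsSymmetric := hS.isSymmetric
  refine ⟨Module.End.Eigenvalues (S : E →ₗ[ℂ] E), inferInstance,
    fun t => (Module.End.eigenspace (S : E →ₗ[ℂ] E) t).starProjection, fun t => t, ?_, ?_, ?_, ?_,
    ?_, ?_⟩
  · ext x
    have h1 := hsym.orthogonalFamily_eigenspaces'.sum_projection_of_mem_iSup x (by
      have := hsym.orthogonalComplement_iSup_eigenspaces_eq_bot'
      rw [Submodule.orthogonal_eq_bot_iff] at this
      rw [this]
      trivial)
    simpa using h1
  · exact fun t => isSelfAdjoint_starProjection _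
  · exact Subtype.val_injective
  · exact fun t => hsym.conj_eigenvalue_eq_self t.2
  · intro t
    ext x
    exact Module.End.mem_eigenspace_iff.mp (Submodule.starProjection_apply_mem _ x)
  · exact fun c hc t =>
      commute_starProjection_of_mem_reducedBy (mem_reducedBy_eigenspace_of_commute hS hc _)

/-- On an eigenspace of `∑ i, A i⋆ A i`, a doubly commuting tuple `A` has the same quadratic forms
as some doubly commuting tuple for which that eigenspace is reducing. -/
theorem exists_doublyCommuting_reducing {ι : Type*} [Fintype ι] [DecidableEq ι]
    (A : ι → E →L[ℂ] E)
    (hA : ∀ i j, i ≠ j → A i * A j = A j * A i ∧ star (A i) * A j = A j * star (A i)) (l : ℝ) :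
    ∃ B : ι → E →L[ℂ] E,
      (∀ i j, i ≠ j → B i * B j = B j * B i ∧ star (B i) * B j = B j * star (B i)) ∧
      ∀ j, B j ∈ reducedBy
          (Module.End.eigenspace ((∑ i, star (A i) * A i : E →L[ℂ] E) : E →ₗ[ℂ] E) (l : ℂ)) ∧
        ∀ x, (∑ i, star (A i) * A i) x = (l : ℂ) • x → ⟪x, A j x⟫_ℂ = ⟪x, B j x⟫_ℂ := by
  have c1 : ∀ i j, i ≠ j → Commute (A i) (A j) := fun i j h => (hA i j h).1
  have c2 : ∀ i j, i ≠ j → Commute (star (A i)) (A j) := fun i j h => (hA i j h).2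
  have c3 : ∀ i j, i ≠ j → Commute (A i) (star (A j)) := fun i j h => (c2 j i h.symm).symm
  have c4 : ∀ i j, i ≠ j → Commute (star (A i)) (star (A j)) := fun i j h => (c1 i j h).star_star
  let S : ι → E →L[ℂ] E := fun i => star (A i) * A i
  have hS : ∀ i, IsSelfAdjoint (S i) := fun i => IsSelfAdjoint.star_mul_self _
  have hAS : ∀ i j, i ≠ j → Commute (A i) (S j) := fun i j h => (c3 i j h).mul_right (c1 i j h)
  have hAS' : ∀ i j, i ≠ j → Commute (star (A i)) (S j) := fun i j h =>
    (c4 i j h).mul_right (c2 i j h)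
  have hSS : ∀ i j, Commute (S i) (S j) := fun i j => by
    rcases eq_or_ne i j with rfl | h
    · exact Commute.refl _
    · exact (hAS' i j h).mul_left (hAS i j h)
  choose κ hκ Q μ hsum hsa hinj hreal heig hcom using fun i => exists_spectral_resolution (hS i)
  have hQQ : ∀ i j s t, Commute (Q i s) (Q j t) := fun i j s t =>
    hcom j _ (hcom i _ (hSS j i) s).symm t
  have hQA : ∀ i j s, i ≠ j → Commute (Q i s) (A j) := fun i j s h =>
    (hcom i _ (hAS j i h.symm) s).symm
  have htot : IsSelfAdjoint (∑ i, S i) := isSelfAdjoint_sum _ fun i _ => hS i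
  have hBA : ∀ i j, i ≠ j → Commute (A i) (pinch (Q j) (A j)) := fun i j h =>
    Commute.pinch_right (fun t => hcom j _ (hAS i j h) t) (c1 i j h)
  have hBA' : ∀ i j, i ≠ j → Commute (star (A i)) (pinch (Q j) (A j)) := fun i j h =>
    Commute.pinch_right (fun t => hcom j _ (hAS' i j h) t) (c2 i j h)
  have hBQ : ∀ i j s, i ≠ j → Commute (Q i s) (pinch (Q j) (A j)) := fun i j s h =>
    Commute.pinch_right (fun t => hQQ i j s t) (hQA i j s h)
  refine ⟨fun j => pinch (Q j) (A j), fun i j h => ⟨?_, ?_⟩, fun j => ⟨?_, fun x hx => ?_⟩⟩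
  · exact (Commute.pinch_right (fun t => (hBQ i j t h).symm) (hBA i j h).symm).symm
  · rw [star_pinch (hsa i)]
    exact (Commute.pinch_right (fun t => (hBQ i j t h).symm) (hBA' i j h).symm).symm
  · refine mem_reducedBy_eigenspace_of_commute htot (Commute.sum_right _ _ _ fun i _ => ?_) _
    rcases eq_or_ne i j with rfl | h
    -- `S i` is the scalar `μ i t` on the range of `Q i t`, so it commutes with each diagonal block.
    · refine Commute.symm (Commute.sum_right _ _ _ fun t _ => ?_)
      have h1 : Q i t * S i = μ i t • Q i t := by
        rw [← heig i t]
        exact (hcom i _ (Commute.refl _) t).eq.symm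
      change S i * (Q i t * A i * Q i t) = Q i t * A i * Q i t * S i
      rw [mul_assoc _ _ (S i), h1, ← mul_assoc (S i), ← mul_assoc (S i), heig i t]
      simp only [smul_mul_assoc, mul_smul_comm]
    · exact ((hBA' i j h).mul_left (hBA i j h)).symm
  -- Unlike `S j`, the operator `R` commutes with `A j`. Since `x` is an eigenvector of `R + S j`,
  -- its components `Q j t x` satisfy eigenvalue equations for `R` with distinct values `l - μ j t`;
  -- hence `A j` has no cross terms between them.
  · let R := ∑ i ∈ Finset.univ.erase j, S i
    have hRsum : R + S j = ∑ i, S i := Finset.sum_erase_add _ _ (Finset.mem_univ j)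
    have hRsa : IsSelfAdjoint R := isSelfAdjoint_sum _ fun i _ => hS i
    have hRA : Commute R (A j) := Commute.sum_left _ _ _ fun i hi =>
      (hAS j i (Finset.ne_of_mem_erase hi).symm).symm
    have hx' : (∑ i, S i) x = (l : ℂ) • x := hx
    have hRQ : ∀ t, R (Q j t x) = ((l : ℂ) - μ j t) • Q j t x := by
      intro t
      have h1 : Commute (∑ i, S i) (Q j t) :=
        hcom j _ (Commute.sum_left _ _ _ fun i _ => hSS i j) t
      have h2 : (∑ i, S i) (Q j t x) = (l : ℂ) • Q j t x := by
        rw [← map_smul, ← hx']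
        exact congrArg (fun T => T x) h1.eq
      have h3 : S j (Q j t x) = μ j t • Q j t x := congrArg (fun T => T x) (heig j t)
      have h4 : R (Q j t x) + S j (Q j t x) = (∑ i, S i) (Q j t x) :=
        congrArg (fun T => T (Q j t x)) hRsum
      rw [sub_smul, ← h2, ← h3, ← h4, add_sub_cancel_right]
    have hcross : ∀ t t', t ≠ t' → ⟪Q j t x, A j (Q j t' x)⟫_ℂ = 0 := by
      intro t t' hne
      have h1 : ⟪Q j t x, R (A j (Q j t' x))⟫_ℂ = ⟪R (Q j t x), A j (Q j t' x)⟫_ℂ := by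
        rw [inner_apply_eq_inner_star, hRsa.star_eq]
      have h2 : R (A j (Q j t' x)) = A j (R (Q j t' x)) := congrArg (fun T => T (Q j t' x)) hRA.eq
      rw [h2, hRQ, hRQ, map_smul, inner_smul_right, inner_smul_left, map_sub, hreal,
        Complex.conj_ofReal] at h1
      have h3 : (μ j t - μ j t') * ⟪Q j t x, A j (Q j t' x)⟫_ℂ = 0 := by linear_combination h1
      exact (mul_eq_zero.mp h3).resolve_left (sub_ne_zero.mpr fun h => hne (hinj j h))
    have hxsum : ∑ t, Q j t x = x := by
      have := congrArg (fun T : E →L[ℂ] E => T x) (hsum j)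
      simpa using this
    calc ⟪x, A j x⟫_ℂ = ⟪∑ t, Q j t x, A j (∑ t, Q j t x)⟫_ℂ := by rw [hxsum]
      _ = ∑ t, ⟪Q j t x, A j (Q j t x)⟫_ℂ := by
        rw [map_sum, sum_inner]
        refine Finset.sum_congr rfl fun t _ => ?_
        rw [inner_sum]
        exact Finset.sum_eq_single t (fun t' _ h => hcross t t' h.symm) (by simp)
      _ = ⟪x, pinch (Q j) (A j) x⟫_ℂ := by
        simp only [pinch, sum_apply, inner_sum]
        refine Finset.sum_congr rfl fun t _ => ?_
        change _ = ⟪x, Q j t (A j (Q j t x))⟫_ℂ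
        rw [inner_apply_eq_inner_star (Q j t), (hsa j t).star_eq]

theorem quadAdditive_eigenspace {ι : Type*} [Fintype ι] [DecidableEq ι] (A : ι → E →L[ℂ] E)
    (hA : ∀ i j, i ≠ j → A i * A j = A j * A i ∧ star (A i) * A j = A j * star (A i)) (l : ℝ) :
    QuadAdditive Finset.univ A
      (Module.End.eigenspace ((∑ i, star (A i) * A i : E →L[ℂ] E) : E →ₗ[ℂ] E) (l : ℂ)) := by
  obtain ⟨B, hB, hred⟩ := exists_doublyCommuting_reducing A hA l
  intro x hx y hy
  obtain ⟨w, hw, hn, hq⟩ :=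
    quadAdditive_of_doublyCommuting B hB Finset.univ _ (fun j _ => (hred j).1) x hx y hy
  refine ⟨w, hw, hn, fun j hj => ?_⟩
  have key : ∀ v ∈ Module.End.eigenspace ((∑ i, star (A i) * A i : E →L[ℂ] E) : E →ₗ[ℂ] E) (l : ℂ),
      ⟪v, A j v⟫_ℂ = ⟪v, B j v⟫_ℂ := fun v hv =>
    (hred j).2 v (Module.End.mem_eigenspace_iff.mp hv)
  rw [key w hw, key x hx, key y hy, hq j hj]

end Pinching

/-! ### Separation and perturbation at a minimizer. -/

section Minimality

variable {E : Type*} [NormedAddCommGroup E] [InnerProductSpace ℂ E]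

theorem sum_norm_sub_smul_sq {ι : Type*} [Fintype ι] (A : ι → E →L[ℂ] E) (z : ι → ℂ) {x : E}
    (hx : ‖x‖ = 1) :
    ∑ i, ‖A i x - z i • x‖ ^ 2 =
      ∑ i, ‖A i x‖ ^ 2 - 2 * (∑ i, starRingEnd ℂ (z i) * ⟪x, A i x⟫_ℂ).re + ∑ i, ‖z i‖ ^ 2 := by
  rw [Complex.re_sum, Finset.mul_sum, ← Finset.sum_sub_distrib, ← Finset.sum_add_distrib]
  refine Finset.sum_congr rfl fun i _ => ?_
  rw [norm_sub_sq (𝕜 := ℂ), ← inner_smul_left, norm_smul, hx, mul_one, inner_re_symm]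
  rfl

/-- Weights enter by scaling the unit vectors by `√a` and `√b`. -/
theorem convex_jointNumericalRange {ι : Type*} [Fintype ι] {A : ι → E →L[ℂ] E}
    {V : Submodule ℂ E} (h : QuadAdditive Finset.univ A V) :
    Convex ℝ ((fun x => fun i => ⟪x, A i x⟫_ℂ) '' {x : E | x ∈ V ∧ ‖x‖ = 1}) := by
  rintro _ ⟨x, ⟨hx, hx1⟩, rfl⟩ _ ⟨y, ⟨hy, hy1⟩, rfl⟩ a b ha hb hab
  obtain ⟨w, hw, hn, hq⟩ := h (((Real.sqrt a : ℝ) : ℂ) • x) (V.smul_mem _ hx)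
    (((Real.sqrt b : ℝ) : ℂ) • y) (V.smul_mem _ hy)
  refine ⟨w, ⟨hw, ?_⟩, ?_⟩
  · rw [norm_real_smul_sq, norm_real_smul_sq, Real.sq_sqrt ha, Real.sq_sqrt hb, hx1, hy1] at hn
    have : ‖w‖ ^ 2 = 1 := by rw [hn]; linarith
    exact (pow_eq_one_iff_of_nonneg (norm_nonneg w) two_ne_zero).mp this
  · funext i
    change ⟪w, A i w⟫_ℂ = a • ⟪x, A i x⟫_ℂ + b • ⟪y, A i y⟫_ℂ
    rw [hq i (Finset.mem_univ i), inner_real_smul_apply, inner_real_smul_apply, Real.sq_sqrt ha,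
      Real.sq_sqrt hb, Complex.real_smul, Complex.real_smul]

variable [CompleteSpace E]

theorem inner_sum_star_mul_self_apply {ι : Type*} [Fintype ι] (A : ι → E →L[ℂ] E) (x : E) :
    ⟪x, (∑ i, star (A i) * A i) x⟫_ℂ = ((∑ i, ‖A i x‖ ^ 2 : ℝ) : ℂ) := by
  rw [sum_apply, inner_sum, Complex.ofReal_sum]
  refine Finset.sum_congr rfl fun i _ => ?_
  rw [← inner_self_eq_ofReal_norm_sq]
  exact inner_star_apply_eq_inner (A i) x (A i x)

/-- A unit vector maximizing `∑ i, ‖A i x‖²` is an eigenvector of `∑ i, A i⋆ A i`. -/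
theorem sum_star_mul_self_apply_of_max {ι : Type*} [Fintype ι] (A : ι → E →L[ℂ] E) {M : ℝ}
    (hM : ∀ x, ‖x‖ = 1 → ∑ i, ‖A i x‖ ^ 2 ≤ M) {x : E} (hx : ‖x‖ = 1)
    (hmax : M ≤ ∑ i, ‖A i x‖ ^ 2) : (∑ i, star (A i) * A i) x = (M : ℂ) • x := by
  have hS : IsSelfAdjoint (∑ i, star (A i) * A i) :=
    isSelfAdjoint_sum _ fun i _ => IsSelfAdjoint.star_mul_self _
  have hre : ∀ y, (∑ i, star (A i) * A i).reApplyInnerSelf y = ∑ i, ‖A i y‖ ^ 2 := fun y => by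
    rw [ContinuousLinearMap.reApplyInnerSelf_apply, inner_re_symm, inner_sum_star_mul_self_apply]
    exact Complex.ofReal_re _
  have hx0 : x ≠ 0 := by
    rintro rfl
    simp at hx
  have hv := hS.hasEigenvector_of_isMaxOn hx0 (fun y hy => by
    have hy1 : ‖y‖ = 1 := by simpa [hx] using hy
    change (∑ i, star (A i) * A i).reApplyInnerSelf y ≤ (∑ i, star (A i) * A i).reApplyInnerSelf x
    rw [hre, hre]
    exact (hM y hy1).trans hmax)
  have happ := hv.apply_eq_smul
  set ν : ℂ := ((⨆ x : { x : E // x ≠ 0 },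
    (∑ i, star (A i) * A i).rayleighQuotient x : ℝ) : ℂ) with hν
  have happ' : (∑ i, star (A i) * A i) x = ν • x := happ
  have h1 := inner_sum_star_mul_self_apply A x
  rw [happ', inner_smul_right, inner_self_eq_ofReal_norm_sq, hx,
    le_antisymm (hM x hx) hmax] at h1
  rw [happ', ← h1]
  simp

variable [FiniteDimensional ℂ E]

/-- If no translate of a doubly commuting tuple `A` by scalars has smaller norm than `A`, then some
unit vector attaining the norm of `A` has vanishing expectations. -/
theorem exists_norm_attaining_of_minimal {ι : Type*} [Fintype ι] [DecidableEq ι]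
    (A : ι → E →L[ℂ] E)
    (hA : ∀ i j, i ≠ j → A i * A j = A j * A i ∧ star (A i) * A j = A j * star (A i)) {M : ℝ}
    (hM : ∀ x, ‖x‖ = 1 → ∑ i, ‖A i x‖ ^ 2 ≤ M)
    (hmin : ∀ z : ι → ℂ, ∃ x, ‖x‖ = 1 ∧ M ≤ ∑ i, ‖A i x - z i • x‖ ^ 2) :
    ∃ x, ‖x‖ = 1 ∧ ∑ i, ‖A i x‖ ^ 2 = M ∧ ∀ i, ⟪x, A i x⟫_ℂ = 0 := by
  have : ProperSpace E := FiniteDimensional.proper ℂ E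
  let V := Module.End.eigenspace ((∑ i, star (A i) * A i : E →L[ℂ] E) : E →ₗ[ℂ] E) (M : ℂ)
  let q : E → ι → ℂ := fun x i => ⟪x, A i x⟫_ℂ
  have hqc : Continuous q := continuous_pi fun i => continuous_id.inner (A i).continuous
  have hac : Continuous fun x => ∑ i, ‖A i x‖ ^ 2 := by fun_prop
  have hK : IsCompact {x : E | x ∈ V ∧ ‖x‖ = 1} := by
    have h1 : {x : E | x ∈ V ∧ ‖x‖ = 1} = Metric.sphere 0 1 ∩ V := by
      ext x
      simp [and_comm]
    rw [h1]
    exact (isCompact_sphere 0 1).inter_right V.closed_of_finiteDimensional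
  have hconv := convex_jointNumericalRange (quadAdditive_eigenspace A hA M)
  have hclosed : IsClosed (q '' {x : E | x ∈ V ∧ ‖x‖ = 1}) := (hK.image hqc).isClosed
  by_cases h0 : (0 : ι → ℂ) ∈ q '' {x : E | x ∈ V ∧ ‖x‖ = 1}
  · obtain ⟨x, ⟨hxV, hx1⟩, hx0⟩ := h0
    refine ⟨x, hx1, ?_, fun i => congrFun hx0 i⟩
    have h1 := inner_sum_star_mul_self_apply A x
    have h2 : (∑ i, star (A i) * A i) x = (M : ℂ) • x := Module.End.mem_eigenspace_iff.mp hxV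
    rw [h2, inner_smul_right, inner_self_eq_ofReal_norm_sq, hx1] at h1
    have h3 : (M : ℂ) = ((∑ i, ‖A i x‖ ^ 2 : ℝ) : ℂ) := by simpa using h1
    exact_mod_cast h3.symm
  exfalso
  obtain ⟨f, u, hu, hfu⟩ := RCLike.geometric_hahn_banach_point_closed (𝕜 := ℂ) hconv hclosed h0
  have hu0 : 0 < u := by simpa using hu
  let c : ι → ℂ := fun i => f (Pi.single i 1)
  have hf : ∀ w : ι → ℂ, f w = ∑ i, c i * w i := by
    intro w
    conv_lhs => rw [← Finset.univ_sum_single w]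
    rw [map_sum]
    refine Finset.sum_congr rfl fun i _ => ?_
    have : Pi.single i (w i) = w i • (Pi.single i 1 : ι → ℂ) := by
      rw [← Pi.single_smul, smul_eq_mul, mul_one]
    rw [this, map_smul, smul_eq_mul, mul_comm]
  let G : ℝ := ∑ i, ‖c i‖ ^ 2
  -- Translate by `ε` times the conjugate of the separating vector `c`, with `ε = 1 / (m + 1)`: this
  -- changes the sum of squares by `-2 ε Re f (q x) + ε² G`.
  have hstep : ∀ m : ℕ, ∃ x, ‖x‖ = 1 ∧ M ≤ ∑ i, ‖A i x‖ ^ 2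
      - 2 * (1 / ((m : ℝ) + 1)) * (f (q x)).re + (1 / ((m : ℝ) + 1)) ^ 2 * G := by
    intro m
    obtain ⟨x, hx, hMx⟩ := hmin fun i => ((1 / ((m : ℝ) + 1) : ℝ) : ℂ) * starRingEnd ℂ (c i)
    refine ⟨x, hx, hMx.trans_eq ?_⟩
    rw [sum_norm_sub_smul_sq A _ hx, hf]
    have e1 : ∑ i, starRingEnd ℂ (((1 / ((m : ℝ) + 1) : ℝ) : ℂ) * starRingEnd ℂ (c i)) *
        ⟪x, A i x⟫_ℂ = ((1 / ((m : ℝ) + 1) : ℝ) : ℂ) * ∑ i, c i * q x i := by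
      rw [Finset.mul_sum]
      refine Finset.sum_congr rfl fun i _ => ?_
      rw [map_mul, Complex.conj_ofReal, Complex.conj_conj, mul_assoc]
    have e2 : ∑ i, ‖((1 / ((m : ℝ) + 1) : ℝ) : ℂ) * starRingEnd ℂ (c i)‖ ^ 2 =
        (1 / ((m : ℝ) + 1)) ^ 2 * G := by
      rw [Finset.mul_sum]
      refine Finset.sum_congr rfl fun i _ => ?_
      rw [norm_mul, mul_pow, Complex.norm_real, Real.norm_eq_abs, sq_abs, RCLike.norm_conj]
    rw [e1, e2, Complex.re_ofReal_mul]
    ring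
  choose x hx1 hxM using hstep
  -- A limit `y` of these vectors attains `M`, so it lies in `V`. The bound `M` on the unperturbed
  -- sums gives `Re f (q x) ≤ ε G / 2`, hence `Re f (q y) ≤ 0` in the limit, against the separation.
  obtain ⟨y, hy, φ, hφ, hlim⟩ := (isCompact_sphere (0 : E) 1).tendsto_subseq
    (x := x) fun m => by simp [hx1]
  have hy1 : ‖y‖ = 1 := by simpa using hy
  have hε : Filter.Tendsto (fun m => 1 / ((φ m : ℝ) + 1)) Filter.atTop (nhds 0) :=
    tendsto_one_div_add_atTop_nhds_zero_nat.comp hφ.tendsto_atTop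
  have hfq : Filter.Tendsto (fun m => (f (q (x (φ m)))).re) Filter.atTop
      (nhds (f (q y)).re) :=
    ((Complex.continuous_re.comp (f.continuous.comp hqc)).tendsto y).comp hlim
  have hfy : (f (q y)).re ≤ 0 := by
    have hle : ∀ m, (f (q (x (φ m)))).re ≤ 1 / ((φ m : ℝ) + 1) * (G / 2) := by
      intro m
      have h1 := hxM (φ m)
      have h2 := hM (x (φ m)) (hx1 _)
      have hpos : 0 < 1 / ((φ m : ℝ) + 1) := by positivity
      have h3 : 0 ≤ 1 / ((φ m : ℝ) + 1) *
          (1 / ((φ m : ℝ) + 1) * G - 2 * (f (q (x (φ m)))).re) := by nlinarith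
      have h4 := nonneg_of_mul_nonneg_right h3 hpos
      linarith
    have := le_of_tendsto_of_tendsto' hfq (hε.mul_const (G / 2)) hle
    simpa using this
  have hMy : M ≤ ∑ i, ‖A i y‖ ^ 2 := by
    have h1 := (((hac.tendsto y).comp hlim).sub ((hε.const_mul 2).mul hfq)).add
      ((hε.pow 2).mul_const G)
    have h2 := ge_of_tendsto' h1 fun m => hxM (φ m)
    simpa using h2
  have hyV : y ∈ V := Module.End.mem_eigenspace_iff.mpr
    (sum_star_mul_self_apply_of_max A hM hy1 hMy)
  have := hfu (q y) ⟨y, ⟨hyV, hy1⟩, rfl⟩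
  exact absurd (hu0.trans this) (not_lt.mpr hfy)

end Minimality

/-! ### Matrix tuples: translation, minimizers and the distance formula. -/

section Tuples

variable {d n : ℕ}

theorem norm_tupleOp_apply_sq (A : Fin d → Matrix (Fin n) (Fin n) ℂ)
    (x : EuclideanSpace ℂ (Fin n)) :
    ‖tupleOp A x‖ ^ 2 = ∑ j, ‖Matrix.toEuclideanCLM (n := Fin n) (𝕜 := ℂ) (A j) x‖ ^ 2 :=
  PiLp.norm_sq_eq_of_L2 _ _

theorem toEuclideanCLM_sub_scalarTuple (A : Fin d → Matrix (Fin n) (Fin n) ℂ) (z : Fin d → ℂ)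
    (j : Fin d) (x : EuclideanSpace ℂ (Fin n)) :
    Matrix.toEuclideanCLM (n := Fin n) (𝕜 := ℂ) ((A - scalarTuple n z) j) x =
      Matrix.toEuclideanCLM (n := Fin n) (𝕜 := ℂ) (A j) x - z j • x := by
  simp [scalarTuple]

theorem tupleOp_sub_scalarTuple (A : Fin d → Matrix (Fin n) (Fin n) ℂ) (z : Fin d → ℂ) :
    tupleOp (A - scalarTuple n z) = tupleOp A - tupleOp (scalarTuple n z) := by
  ext x j i
  simp [tupleOp]

/-- For a unit vector, the squared norm and the squared modulus of the expectation change by the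
same amount in each coordinate. -/
theorem tupleVar_sub_scalarTuple (A : Fin d → Matrix (Fin n) (Fin n) ℂ) (z : Fin d → ℂ)
    {x : EuclideanSpace ℂ (Fin n)} (hx : ‖x‖ = 1) :
    tupleVar (A - scalarTuple n z) x = tupleVar A x := by
  simp only [tupleVar, norm_tupleOp_apply_sq, toEuclideanCLM_sub_scalarTuple]
  rw [← Finset.sum_sub_distrib, ← Finset.sum_sub_distrib]
  refine Finset.sum_congr rfl fun j _ => ?_
  set y := Matrix.toEuclideanCLM (n := Fin n) (𝕜 := ℂ) (A j) x
  have h1 : ⟪x, y - z j • x⟫_ℂ = ⟪x, y⟫_ℂ - z j := by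
    rw [inner_sub_right, inner_smul_right, inner_self_eq_ofReal_norm_sq, hx]
    simp
  have h2 : ⟪y, z j • x⟫_ℂ = z j * starRingEnd ℂ ⟪x, y⟫_ℂ := by
    rw [inner_smul_right, inner_conj_symm]
  rw [h1, norm_sub_sq (𝕜 := ℂ), h2, norm_smul, hx, Complex.sq_norm, Complex.sq_norm,
    Complex.normSq_sub, mul_one, Complex.sq_norm]
  have h3 : (⟪x, y⟫_ℂ * starRingEnd ℂ (z j)).re = (z j * starRingEnd ℂ ⟪x, y⟫_ℂ).re := by
    simp only [Complex.mul_re, Complex.conj_re, Complex.conj_im]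
    ring
  rw [h3]
  change _ - 2 * (z j * starRingEnd ℂ ⟪x, y⟫_ℂ).re + _ - _ = _
  ring

theorem tupleVar_le_norm_tupleOp_sq (A : Fin d → Matrix (Fin n) (Fin n) ℂ)
    {x : EuclideanSpace ℂ (Fin n)} (hx : ‖x‖ = 1) : tupleVar A x ≤ ‖tupleOp A‖ ^ 2 := by
  have h1 : ‖tupleOp A x‖ ≤ ‖tupleOp A‖ := (tupleOp A).unit_le_opNorm x hx.le
  have h2 : 0 ≤ ∑ j, ‖⟪x, Matrix.toEuclideanCLM (n := Fin n) (𝕜 := ℂ) (A j) x⟫_ℂ‖ ^ 2 :=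
    Finset.sum_nonneg fun j _ => sq_nonneg _
  have h3 : ‖tupleOp A x‖ ^ 2 ≤ ‖tupleOp A‖ ^ 2 := by gcongr
  unfold tupleVar
  linarith

theorem exists_norm_tupleOp_apply_eq (hn : 0 < n) (A : Fin d → Matrix (Fin n) (Fin n) ℂ) :
    ∃ x : EuclideanSpace ℂ (Fin n), ‖x‖ = 1 ∧ ‖tupleOp A x‖ = ‖tupleOp A‖ := by
  obtain ⟨x, hx, hmax⟩ := (isCompact_sphere (0 : EuclideanSpace ℂ (Fin n)) 1).exists_isMaxOn
    ⟨EuclideanSpace.single ⟨0, hn⟩ 1, by simp⟩ (tupleOp A).continuous.norm.continuousOn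
  have hx1 : ‖x‖ = 1 := by simpa using hx
  refine ⟨x, hx1, le_antisymm ((tupleOp A).unit_le_opNorm x hx1.le) ?_⟩
  exact ContinuousLinearMap.opNorm_le_of_unit_norm (norm_nonneg _) fun y hy =>
    hmax (by simpa using hy)

theorem DoublyCommuting.sub_scalarTuple {A : Fin d → Matrix (Fin n) (Fin n) ℂ}
    (hA : DoublyCommuting A) (z : Fin d → ℂ) : DoublyCommuting (A - scalarTuple n z) := by
  intro i j hij
  obtain ⟨h1, h2⟩ := hA i j hij
  have hz : ∀ j (X : Matrix (Fin n) (Fin n) ℂ), Commute (scalarTuple n z j) X := fun j X =>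
    (Commute.one_left X).smul_left (z j)
  refine ⟨?_, ?_⟩
  · exact (Commute.sub_left (Commute.sub_right h1 (hz j _).symm) (hz i _)).eq
  · have h3 : ((A - scalarTuple n z) i)ᴴ = (A i)ᴴ - scalarTuple n (star z) i := by
      simp [scalarTuple]
    rw [h3]
    exact (Commute.sub_left (Commute.sub_right h2 (hz j _).symm)
      ((Commute.one_left _).smul_left _)).eq

theorem norm_le_norm_tupleOp_scalarTuple (hn : 0 < n) (z : Fin d → ℂ) :
    ‖z‖ ≤ ‖tupleOp (scalarTuple n z)‖ := by
  refine (pi_norm_le_iff_of_nonneg (norm_nonneg _)).mpr fun j => ?_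
  have he : ‖(EuclideanSpace.single ⟨0, hn⟩ 1 : EuclideanSpace ℂ (Fin n))‖ = 1 := by simp
  set e : EuclideanSpace ℂ (Fin n) := EuclideanSpace.single ⟨0, hn⟩ 1
  have h1 : ‖tupleOp (scalarTuple n z) e‖ ≤ ‖tupleOp (scalarTuple n z)‖ :=
    (tupleOp (scalarTuple n z)).unit_le_opNorm e he.le
  refine le_trans ?_ h1
  have h2 : ‖(tupleOp (scalarTuple n z) e) j‖ ≤ ‖tupleOp (scalarTuple n z) e‖ :=
    PiLp.norm_apply_le _ j
  have h3 : (tupleOp (scalarTuple n z) e) j = z j • e := by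
    simp [tupleOp, scalarTuple]
  rwa [h3, norm_smul, he, mul_one] at h2

theorem continuous_norm_sub_linearMap {F : Type*} [NormedAddCommGroup F] [NormedSpace ℂ F]
    (T : F) (L : (Fin d → ℂ) →ₗ[ℂ] F) : Continuous fun z => ‖T - L z‖ :=
  (continuous_const.sub L.continuous_of_finiteDimensional).norm

/-- The function is continuous and bounded below by `‖z‖ - ‖tupleOp A‖`, hence coercive on a
finite-dimensional space. -/
theorem exists_minimizer_norm_tupleOp_sub (hn : 0 < n) (A : Fin d → Matrix (Fin n) (Fin n) ℂ) :
    ∃ z : Fin d → ℂ, ∀ w : Fin d → ℂ,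
      ‖tupleOp (A - scalarTuple n z)‖ ≤ ‖tupleOp (A - scalarTuple n w)‖ := by
  obtain ⟨L, hL⟩ : ∃ L : (Fin d → ℂ) →ₗ[ℂ] EuclideanSpace ℂ (Fin n) →L[ℂ]
      PiLp 2 (fun _ : Fin d => EuclideanSpace ℂ (Fin n)), ∀ z, L z = tupleOp (scalarTuple n z) :=
    ⟨{ toFun := fun z => tupleOp (scalarTuple n z)
       map_add' := fun z w => by
        ext x j i
        simp [tupleOp, scalarTuple, add_mul]
       map_smul' := fun r z => by
        ext x j i
        simp [tupleOp, scalarTuple, mul_assoc] }, fun _ => rfl⟩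
  have hcont : Continuous fun z => ‖tupleOp (A - scalarTuple n z)‖ := by
    simp only [tupleOp_sub_scalarTuple, ← hL]
    exact continuous_norm_sub_linearMap _ L
  refine hcont.exists_forall_le ?_
  refine Filter.tendsto_atTop_mono (f := fun z : Fin d → ℂ => ‖z‖ - ‖tupleOp A‖) (fun z => ?_)
    (Filter.tendsto_atTop_add_const_right _ _ tendsto_norm_cocompact_atTop)
  have h1 := norm_le_norm_tupleOp_scalarTuple hn z
  have h2 := norm_sub_norm_le (tupleOp (scalarTuple n z)) (tupleOp A)
  rw [norm_sub_rev, ← tupleOp_sub_scalarTuple] at h2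
  linarith

theorem exists_tupleVar_eq_of_minimal (hn : 0 < n) {A : Fin d → Matrix (Fin n) (Fin n) ℂ}
    (hA : DoublyCommuting A) (hmin : ∀ z, ‖tupleOp A‖ ≤ ‖tupleOp (A - scalarTuple n z)‖) :
    ∃ x : EuclideanSpace ℂ (Fin n), ‖x‖ = 1 ∧ tupleVar A x = ‖tupleOp A‖ ^ 2 := by
  let T : Fin d → EuclideanSpace ℂ (Fin n) →L[ℂ] EuclideanSpace ℂ (Fin n) :=
    fun j => Matrix.toEuclideanCLM (n := Fin n) (𝕜 := ℂ) (A j)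
  have hT : ∀ i j, i ≠ j → T i * T j = T j * T i ∧ star (T i) * T j = T j * star (T i) := by
    intro i j hij
    obtain ⟨h1, h2⟩ := hA i j hij
    rw [← Matrix.star_eq_conjTranspose] at h2
    simp only [T]
    rw [← map_mul, ← map_mul, h1, ← map_star, ← map_mul, ← map_mul, h2]
    exact ⟨rfl, rfl⟩
  have hM : ∀ x, ‖x‖ = 1 → ∑ i, ‖T i x‖ ^ 2 ≤ ‖tupleOp A‖ ^ 2 := by
    intro x hx
    rw [← norm_tupleOp_apply_sq]
    exact pow_le_pow_left₀ (norm_nonneg _) ((tupleOp A).unit_le_opNorm x hx.le) 2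
  have hz : ∀ z : Fin d → ℂ, ∃ x, ‖x‖ = 1 ∧ ‖tupleOp A‖ ^ 2 ≤ ∑ i, ‖T i x - z i • x‖ ^ 2 := by
    intro z
    obtain ⟨x, hx, hxn⟩ := exists_norm_tupleOp_apply_eq hn (A - scalarTuple n z)
    refine ⟨x, hx, ?_⟩
    have h1 : ∑ i, ‖T i x - z i • x‖ ^ 2 = ‖tupleOp (A - scalarTuple n z)‖ ^ 2 := by
      rw [← hxn, norm_tupleOp_apply_sq]
      exact Finset.sum_congr rfl fun j _ => by rw [toEuclideanCLM_sub_scalarTuple]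
    rw [h1]
    exact pow_le_pow_left₀ (norm_nonneg _) (hmin z) 2
  obtain ⟨x, hx, hnorm, hzero⟩ := exists_norm_attaining_of_minimal T hT hM hz
  refine ⟨x, hx, ?_⟩
  have h1 : ∑ j, ‖⟪x, T j x⟫_ℂ‖ ^ 2 = 0 := Finset.sum_eq_zero fun j _ => by simp [hzero j]
  rw [tupleVar, norm_tupleOp_apply_sq, hnorm, h1, sub_zero]

end Tuples

theorem theorem6 {d n : ℕ} (hn : 0 < n) (A : Fin d → Matrix (Fin n) (Fin n) ℂ)
    (hA : DoublyCommuting A) :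
    IsLeast (Set.range fun z : Fin d → ℂ => ‖tupleOp (A - scalarTuple n z)‖) (distToScalars A) ∧
      IsGreatest {v : ℝ | ∃ x : EuclideanSpace ℂ (Fin n), ‖x‖ = 1 ∧ v = tupleVar A x}
        (distToScalars A ^ 2) := by
  obtain ⟨z, hz⟩ := exists_minimizer_norm_tupleOp_sub hn A
  have hleast : IsLeast (Set.range fun z : Fin d → ℂ => ‖tupleOp (A - scalarTuple n z)‖)
      ‖tupleOp (A - scalarTuple n z)‖ := ⟨⟨z, rfl⟩, by rintro _ ⟨w, rfl⟩; exact hz w⟩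
  have hdist : distToScalars A = ‖tupleOp (A - scalarTuple n z)‖ := hleast.csInf_eq
  rw [hdist]
  refine ⟨hleast, ?_, ?_⟩
  -- Recentering at the minimizer `z` puts the optimal translation at `0`.
  · obtain ⟨x, hx, hvar⟩ := exists_tupleVar_eq_of_minimal hn (hA.sub_scalarTuple z) fun w => by
      have h1 : A - scalarTuple n z - scalarTuple n w = A - scalarTuple n (z + w) := by
        funext j
        simp only [Pi.sub_apply, scalarTuple, Pi.add_apply, add_smul, sub_sub]
      rw [h1]
      exact hz (z + w)
    exact ⟨x, hx, by rw [← hvar, tupleVar_sub_scalarTuple A z hx]⟩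
  · rintro _ ⟨x, hx, rfl⟩
    rw [← tupleVar_sub_scalarTuple A z hx]
    exact tupleVar_le_norm_tupleOp_sq _ hx
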